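/- Let $\hbar,m,g,L>0$ and $\lambda\in\mathbb R$, and let $0<\xi_1<\xi_2<\cdots$ be the eigenvalues of $-\frac{d^2}{dx^2}$ on $(0,L)$ with Dirichlet boundary conditions. Put $\beta_k=-\left(\frac{\hbar^2\xi_k}{4m}-\hbar\lambda\right)$, $k=1,2,\dots$. For $\beta\in\mathbb R$ consider the boundary value problem $$-\frac{\hbar^2}{4m}\varphi''+(\beta-\hbar\lambda)\varphi+g|\varphi|^2\varphi=0\ \text{ in }(0,L),\qquad \varphi(0)=\varphi(L)=0, \tag{$*$}$$ for classical solutions $\varphi$ with values in $\mathbb K=\mathbb R$ (where $|\varphi|^2\varphi=\varphi^3$) or $\mathbb K=\mathbb C$. Let $\mathcal N_{\mathbb K}\subset\mathbb R\times C([0,L];\mathbb K)$ be the set of pairs $(\beta,\varphi)$ for which $\varphi\not\equiv0$ solves $(*)$. The branch $\Gamma_k$ bifurcating from $(\beta_k,0)$ is the connected component of $\overline{\mathcal N_{\mathbb K}}$ that contains $(\beta_k,0)$, where $C([0,L];\mathbb K)$ carries the uniform norm. A family $(\varphi_k(\cdot,\beta))_{\beta\in I_k}$ is said to bifurcate from $(\beta_k,0)$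 if $I_k\subset\mathbb R$ is an interval with $\beta_k\in\overline{I_k}$, each $\varphi_k(\cdot,\beta)$ is a nontrivial solution of $(*)$ for that $\beta$, the map $\beta\mapsto\varphi_k(\cdot,\beta)\in C([0,L];\mathbb K)$ is continuous on $I_k$, and $\varphi_k(\cdot,\beta)\to0$ as $\beta\to\beta_k$ in $I_k$. Then: (1) Let $i\neq j$, and $\mathbb K=\mathbb R$ or $\mathbb K=\mathbb C$. If families $\varphi_i$ and $\varphi_j$ bifurcate from $(\beta_i,0)$ and $(\beta_j,0)$, then there is no $\theta\in I_i\cap I_j$ with $\varphi_i(\cdot,\theta)=\varphi_j(\cdot,\theta)$. Moreover, the branches do not intersect: $\Gamma_i\cap\Gamma_j=\emptyset$. (2) If $\beta_{j+1}<\beta<\beta_j$ for some $j\in\{1,2,\dots\}$, then $(*)$ has at least $2j$ distinct nontrivial real-valued solutions $\varphi$, each of which is a bifurcation solution, i.e. $(\beta,\varphi)\in\Gamma_k$ (with $\mathbb K=\mathbb R$) for some $k$. -/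

import Mathlib

open Set Filter Topology

namespace BEC

/-- The real number `μ` is an eigenvalue of `-d²/dx²` on `(0, L)` with homogeneous Dirichlet
boundary condition: `-e'' = μ e` in `(0, L)`, `e(0) = e(L) = 0`, for some `e ≢ 0`. -/
def IsDirichletEigenvalue (L μ : ℝ) : Prop :=
  ∃ e : ℝ → ℝ, ContinuousOn e (Icc 0 L) ∧ ContDiffOn ℝ 2 e (Ioo 0 L) ∧
    (∀ x ∈ Ioo 0 L, -deriv (deriv e) x = μ * e x) ∧
    e 0 = 0 ∧ e L = 0 ∧ ∃ x ∈ Icc 0 L, e x ≠ 0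

/-- `ξ 1 < ξ 2 < ⋯` is the increasing enumeration of all Dirichlet eigenvalues of `-d²/dx²` on
`(0, L)`. In one space dimension every eigenvalue is simple, so this is also the
enumeration with multiplicities. -/
structure IsDirichletSpectrum (L : ℝ) (ξ : ℕ+ → ℝ) : Prop where
  strictMono : StrictMono ξ
  range_eq : range ξ = {μ : ℝ | IsDirichletEigenvalue L μ}

/-- The critical value `β_k = -(ħ² ξ_k / (4m) - ħ λ)` belonging to the eigenvalue `ξ_k`. -/
noncomputable def criticalValue (hbar m lam ξk : ℝ) : ℝ :=
  -(hbar ^ 2 * ξk / (4 * m) - hbar * lam)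

/-- `f` is a classical solution on `[0, L]` of the boundary value problem
`-(ħ²/4m) f'' + (β - ħλ) f + g |f|² f = 0` in `(0, L)`, `f(0) = f(L) = 0`.
For real-valued `f` the last term is `g f³`. -/
structure IsSolution {𝕜 : Type*} [RCLike 𝕜] (hbar m lam g L β : ℝ) (f : ℝ → 𝕜) : Prop where
  continuousOn : ContinuousOn f (Icc 0 L)
  contDiffOn : ContDiffOn ℝ 2 f (Ioo 0 L)
  equation : ∀ x ∈ Ioo 0 L,
    -((hbar ^ 2 / (4 * m)) • deriv (deriv f) x) + (β - hbar * lam) • f x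
      + g • (‖f x‖ ^ 2 • f x) = 0
  left : f 0 = 0
  right : f L = 0

/-- For real-valued functions the nonlinear term is the cube. -/
theorem norm_sq_smul_real (y : ℝ) : ‖y‖ ^ 2 • y = y ^ 3 := by
  rw [Real.norm_eq_abs, sq_abs, smul_eq_mul]
  ring

/-- The pairs `(β, φ)`, with `φ ∈ C([0, L])` a nontrivial solution for the parameter value `β`. -/
def nontrivialSolutions (𝕜 : Type*) [RCLike 𝕜] (hbar m lam g L : ℝ) :
    Set (ℝ × C(Icc (0 : ℝ) L, 𝕜)) :=
  {p | p.2 ≠ 0 ∧ ∃ f : ℝ → 𝕜, IsSolution hbar m lam g L p.1 f ∧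
    ∀ x : Icc (0 : ℝ) L, p.2 x = f x}

/-- The branch bifurcating from `(b, 0)`: the connected component containing `(b, 0)` of the closure
of the set of nontrivial solutions in `ℝ × C([0, L])`. -/
def branch (𝕜 : Type*) [RCLike 𝕜] (hbar m lam g L b : ℝ) :
    Set (ℝ × C(Icc (0 : ℝ) L, 𝕜)) :=
  connectedComponentIn (closure (nontrivialSolutions 𝕜 hbar m lam g L)) (b, 0)

/-- The family `β ↦ φ(·, β)`, `β ∈ I`, of nontrivial solutions, parametrized continuously by an
interval `I` whose closure contains `b`, bifurcates from `(b, 0)`: it tends to zero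
as `β → b` in `I`. -/
structure IsBifurcatingFamily {𝕜 : Type*} [RCLike 𝕜] (hbar m lam g L b : ℝ)
    (I : Set ℝ) (φ : ℝ → C(Icc (0 : ℝ) L, 𝕜)) : Prop where
  ordConnected : I.OrdConnected
  mem_closure : b ∈ closure I
  continuousOn : ContinuousOn φ I
  solution : ∀ β ∈ I, (β, φ β) ∈ nontrivialSolutions 𝕜 hbar m lam g L
  tendsto : Tendsto φ (𝓝[I] b) (𝓝 0)

end BEC

/-!
The problem is explicitly solvable. With `b = 4 m g / ħ²` and `μ = 4 m (ħ λ - β) / ħ²` the equation is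
`f'' = (b |f|² - μ) f`. The function `y = sin θ`, where `θ' = √(1 + s² cos² θ)` and `θ(0) = 0`, satisfies
`y'' = -(1 + 2 s²) y + 2 s² y³` and vanishes exactly at the multiples of the half period
`T(s) = ∫₀^π dθ / √(1 + s² cos² θ)`. Hence, for `ω = k T(s) / L` and `|c| = 1`, the function
`√(2 / b) s ω y(ω x) c` solves the boundary value problem for `μ = ω² (1 + 2 s²)`. These pairs, for
`s ∈ ℝ` and `|c| = 1`, form the `k`-th *sheet* (`BEC.sheet`); it passes through the bifurcation point
`(β_k, 0)` at `s = 0`.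

Conversely, every nontrivial solution lies on a sheet (`BEC.IsCubicSolution.exists_wave`). The angular
momentum vanishes at `0`, hence everywhere, so that `f' = 0` where `|f|` is maximal; conservation of
energy then gives `b max |f|² ≤ μ`, uniqueness for the initial value problem excludes equality (the
solution would be a nonzero constant), and this is the range in which `s`, `ω` can be chosen such that
the standing wave has the same initial velocity as `f`. Uniqueness identifies the two. For `b = 0` the
same argument shows that the Dirichlet eigenvalues are `(k π / L)²`.

The sheets are pairwise disjoint, since the first positive zero `L / k` of the solutions is different on
each. They are closed and locally finite, because `T(s)² (1 + 2 s²)` is at least `π²` and tends to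
infinity with `s`. So a connected subset of the closure of the set of nontrivial solutions lies in one
sheet: the branch through `(β_k, 0)` is contained in the `k`-th sheet, and different branches are
disjoint. A bifurcating family is contained in its branch. Letting `s` go to `0` shows that the branch
contains the whole curve `s ↦ (β, f)`. If `β < β_j`, the intermediate value theorem gives, for each
`k ≤ j`, some `s > 0` at which the `k`-th sheet has the parameter value `β`; the values `± s` for
`k = 1, …, j` are the `2 j` solutions.
-/

namespace BEC

/-! ### Travel time, angle and the standing wave -/

/-- Angular speed of the standing wave of modulus `s`: the wave is `sin θ(u)` where
`θ' = √(1 + s² cos² θ)`. This is a Jacobi sine with elliptic modulus `κ² = s² / (1 + s²)`, rescaled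
so that every real `s` is admissible and the speed is smooth in `s`. -/
noncomputable def angularSpeed (s t : ℝ) : ℝ := √(1 + s ^ 2 * Real.cos t ^ 2)

theorem angularSpeed_sq (s t : ℝ) : angularSpeed s t ^ 2 = 1 + s ^ 2 * Real.cos t ^ 2 :=
  Real.sq_sqrt (by positivity)

theorem angularSpeed_pos (s t : ℝ) : 0 < angularSpeed s t :=
  Real.sqrt_pos.2 (by positivity)

theorem continuous_angularSpeed_inv :
    Continuous fun p : ℝ × ℝ => (angularSpeed p.1 p.2)⁻¹ := by
  refine Continuous.inv₀ ?_ fun p => (angularSpeed_pos _ _).ne'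
  unfold angularSpeed
  fun_prop

theorem continuous_angularSpeed_inv_right (s : ℝ) :
    Continuous fun t => (angularSpeed s t)⁻¹ :=
  continuous_angularSpeed_inv.comp (Continuous.prodMk_right s)

theorem hasDerivAt_angularSpeed (s t : ℝ) :
    HasDerivAt (angularSpeed s) (-(s ^ 2 * Real.cos t * Real.sin t) / angularSpeed s t) t := by
  have h := (((Real.hasDerivAt_cos t).pow 2).const_mul (s ^ 2)).const_add 1 |>.sqrt
    (by positivity : 1 + s ^ 2 * Real.cos t ^ 2 ≠ 0)
  refine h.congr_deriv ?_
  change _ = _ / √(1 + s ^ 2 * Real.cos t ^ 2)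
  rw [Pi.pow_apply]
  have : √(1 + s ^ 2 * Real.cos t ^ 2) ≠ 0 := (angularSpeed_pos s t).ne'
  field_simp
  ring

/-- The time in which a particle of speed `angularSpeed s` gets from the angle `0` to `θ`
(an incomplete elliptic integral of the first kind); `travelTime s π` is the half period. -/
noncomputable def travelTime (s θ : ℝ) : ℝ := ∫ t in (0 : ℝ)..θ, (angularSpeed s t)⁻¹

theorem travelTime_zero (s : ℝ) : travelTime s 0 = 0 := intervalIntegral.integral_same

theorem continuous_travelTime_left (θ : ℝ) : Continuous fun s => travelTime s θ :=
  intervalIntegral.continuous_parametric_intervalIntegral_of_continuous'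
    (f := fun s t => (angularSpeed s t)⁻¹) continuous_angularSpeed_inv 0 θ

theorem hasDerivAt_travelTime (s θ : ℝ) :
    HasDerivAt (travelTime s) (angularSpeed s θ)⁻¹ θ :=
  (continuous_angularSpeed_inv_right s).integral_hasStrictDerivAt 0 θ |>.hasDerivAt

theorem strictMono_travelTime (s : ℝ) : StrictMono (travelTime s) :=
  strictMono_of_deriv_pos fun θ => by
    rw [(hasDerivAt_travelTime s θ).deriv]
    exact inv_pos.2 (angularSpeed_pos s θ)

theorem travelTime_nat_mul_pi (s : ℝ) (n : ℕ) :
    travelTime s (n * Real.pi) = n * travelTime s Real.pi := by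
  have hp : Function.Periodic (fun t => (angularSpeed s t)⁻¹) Real.pi := fun t => by
    simp [angularSpeed, Real.cos_add_pi]
  have h := hp.intervalIntegral_add_zsmul_eq n 0
    (fun a b => (continuous_angularSpeed_inv_right s).intervalIntegrable a b)
  simpa [travelTime] using h

theorem travelTime_neg_angle (s θ : ℝ) : travelTime s (-θ) = -travelTime s θ := by
  have h := intervalIntegral.integral_comp_neg (a := 0) (b := θ)
    (fun t => (angularSpeed s t)⁻¹)
  rw [travelTime, travelTime, intervalIntegral.integral_symm, neg_inj]
  simpa [angularSpeed] using h.symm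

theorem travelTime_neg (s θ : ℝ) : travelTime (-s) θ = travelTime s θ := by
  simp [travelTime, angularSpeed]

theorem travelTime_pi_pos (s : ℝ) : 0 < travelTime s Real.pi := by
  rw [← travelTime_zero s]
  exact strictMono_travelTime s Real.pi_pos

theorem surjective_travelTime (s : ℝ) : Function.Surjective (travelTime s) := by
  have hT := travelTime_pi_pos s
  have hc : Continuous (travelTime s) :=
    continuous_iff_continuousAt.2 fun θ => (hasDerivAt_travelTime s θ).continuousAt
  intro u
  obtain ⟨n, hn⟩ := exists_nat_ge (|u| / travelTime s Real.pi)
  have hn' : |u| ≤ travelTime s (n * Real.pi) := by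
    rw [travelTime_nat_mul_pi]
    exact (div_le_iff₀ hT).1 hn
  refine mem_range_of_exists_le_of_exists_ge hc ⟨-(n * Real.pi), ?_⟩ ⟨n * Real.pi, ?_⟩
  · rw [travelTime_neg_angle]
    linarith [neg_abs_le u]
  · exact (le_abs_self u).trans hn'

/-- The travel time is an increasing bijection of the line, so that the motion can be defined as its
inverse, without an existence theorem for differential equations. -/
noncomputable def travelTimeIso (s : ℝ) : ℝ ≃o ℝ :=
  (strictMono_travelTime s).orderIsoOfSurjective _ (surjective_travelTime s)

/-- The angle reached at time `u`: the solution of `θ' = angularSpeed s θ`, `θ(0) = 0`. -/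
noncomputable def angle (s u : ℝ) : ℝ := (travelTimeIso s).symm u

theorem travelTime_angle (s u : ℝ) : travelTime s (angle s u) = u :=
  (travelTimeIso s).apply_symm_apply u

theorem angle_travelTime (s θ : ℝ) : angle s (travelTime s θ) = θ :=
  (travelTimeIso s).symm_apply_apply θ

theorem angle_lt_iff {s u θ : ℝ} : angle s u < θ ↔ u < travelTime s θ := by
  rw [← (strictMono_travelTime s).lt_iff_lt, travelTime_angle]

theorem lt_angle_iff {s u θ : ℝ} : θ < angle s u ↔ travelTime s θ < u := by
  rw [← (strictMono_travelTime s).lt_iff_lt, travelTime_angle]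

theorem angle_zero (s : ℝ) : angle s 0 = 0 := by
  simpa [travelTime_zero] using angle_travelTime s 0

/-- Joint continuity. Since `angle s u < θ` means `u < travelTime s θ`, the preimages of rays are open
as soon as the travel time is continuous in `s` for each fixed angle. -/
theorem continuous_angle : Continuous fun p : ℝ × ℝ => angle p.1 p.2 := by
  refine OrderTopology.continuous_iff.2 fun θ => ⟨?_, ?_⟩
  · have : (fun p : ℝ × ℝ => angle p.1 p.2) ⁻¹' Ioi θ = {p | travelTime p.1 θ < p.2} := by
      ext p; exact lt_angle_iff
    rw [this]
    exact isOpen_lt ((continuous_travelTime_left θ).comp continuous_fst) continuous_snd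
  · have : (fun p : ℝ × ℝ => angle p.1 p.2) ⁻¹' Iio θ = {p | p.2 < travelTime p.1 θ} := by
      ext p; exact angle_lt_iff
    rw [this]
    exact isOpen_lt continuous_snd ((continuous_travelTime_left θ).comp continuous_fst)

theorem hasDerivAt_angle (s u : ℝ) : HasDerivAt (angle s) (angularSpeed s (angle s u)) u := by
  have h := HasDerivAt.of_local_left_inverse (f := travelTime s) (g := angle s) (a := u)
    (travelTimeIso s).symm.continuous.continuousAt (hasDerivAt_travelTime s (angle s u))
    (inv_pos.2 (angularSpeed_pos _ _)).ne' (Eventually.of_forall fun v => travelTime_angle s v)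
  rwa [inv_inv] at h

/-- The standing wave `y = sin θ`, which solves `y'' = -(1 + 2 s²) y + 2 s² y³`, `y(0) = 0`. -/
noncomputable def wave (s u : ℝ) : ℝ := Real.sin (angle s u)

/-- The derivative of `wave s`. -/
noncomputable def waveDeriv (s u : ℝ) : ℝ :=
  Real.cos (angle s u) * angularSpeed s (angle s u)

theorem hasDerivAt_wave (s u : ℝ) : HasDerivAt (wave s) (waveDeriv s u) u :=
  (hasDerivAt_angle s u).sin

theorem hasDerivAt_waveDeriv (s u : ℝ) :
    HasDerivAt (waveDeriv s) (-(1 + 2 * s ^ 2) * wave s u + 2 * s ^ 2 * wave s u ^ 3) u := by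
  have ha := hasDerivAt_angle s u
  have h := ha.cos.mul ((hasDerivAt_angularSpeed s (angle s u)).comp u ha)
  refine h.congr_deriv ?_
  have h0 := (angularSpeed_pos s (angle s u)).ne'
  have h2 := angularSpeed_sq s (angle s u)
  have h3 := Real.sin_sq_add_cos_sq (angle s u)
  rw [div_mul_cancel₀ _ h0]
  simp only [wave, Function.comp_apply]
  linear_combination (-Real.sin (angle s u)) * h2 +
    (-2 * s ^ 2 * Real.sin (angle s u)) * h3

theorem continuous_wave : Continuous fun p : ℝ × ℝ => wave p.1 p.2 :=
  Real.continuous_sin.comp continuous_angle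

theorem wave_zero (s : ℝ) : wave s 0 = 0 := by simp [wave, angle_zero]

theorem waveDeriv_zero (s : ℝ) : waveDeriv s 0 = √(1 + s ^ 2) := by
  simp [waveDeriv, angle_zero, angularSpeed]

theorem wave_nat_mul (s : ℝ) (n : ℕ) : wave s (n * travelTime s Real.pi) = 0 := by
  rw [wave, ← travelTime_nat_mul_pi, angle_travelTime, Real.sin_nat_mul_pi]

theorem wave_pos {s u : ℝ} (h0 : 0 < u) (h1 : u < travelTime s Real.pi) : 0 < wave s u := by
  apply Real.sin_pos_of_pos_of_lt_pi
  · rwa [lt_angle_iff, travelTime_zero]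
  · rwa [angle_lt_iff]

theorem exists_nat_of_wave_eq_zero {s u : ℝ} (hu : 0 < u) (h : wave s u = 0) :
    ∃ k : ℕ+, u = k * travelTime s Real.pi := by
  obtain ⟨n, hn⟩ := Real.sin_eq_zero_iff.1 h
  have hpos : 0 < angle s u := by rwa [lt_angle_iff, travelTime_zero]
  have hn0 : 0 < n := by
    rw [← hn] at hpos
    exact_mod_cast pos_of_mul_pos_left hpos Real.pi_pos.le
  lift n to ℕ using hn0.le
  refine ⟨⟨n, by exact_mod_cast hn0⟩, ?_⟩
  rw [PNat.mk_coe, ← travelTime_nat_mul_pi, ← travelTime_angle s u, ← hn, Int.cast_natCast]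

theorem travelTime_zero_left (θ : ℝ) : travelTime 0 θ = θ := by
  simp [travelTime, angularSpeed]

/-! ### Size of the half period -/

/-- The number `T(s)² (1 + 2 s²)`, where `T(s)` is the half period: the value of `μ` for which
`f'' = (b |f|² - μ) f` has a solution of modulus `s` with one half wave on an interval of length `1`.
With `k` half waves on an interval of length `L` the value is `(k / L)²` times as large. -/
noncomputable def levelFactor (s : ℝ) : ℝ := travelTime s Real.pi ^ 2 * (1 + 2 * s ^ 2)

theorem continuous_levelFactor : Continuous levelFactor := by
  have := continuous_travelTime_left Real.pi
  unfold levelFactor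
  fun_prop

theorem levelFactor_zero : levelFactor 0 = Real.pi ^ 2 := by
  simp [levelFactor, travelTime_zero_left]

theorem levelFactor_neg (s : ℝ) : levelFactor (-s) = levelFactor s := by
  simp [levelFactor, travelTime_neg]

theorem pi_sq_le_levelFactor (s : ℝ) : Real.pi ^ 2 ≤ levelFactor s := by
  have h1 : Real.pi * (√(1 + s ^ 2))⁻¹ ≤ travelTime s Real.pi := by
    have h := intervalIntegral.integral_mono_on (a := 0) (b := Real.pi) (μ := MeasureTheory.volume)
      (f := fun _ => (√(1 + s ^ 2))⁻¹) (g := fun t => (angularSpeed s t)⁻¹) Real.pi_pos.le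
      (by simp) ((continuous_angularSpeed_inv_right s).intervalIntegrable _ _)
      (fun t _ => by
        refine inv_anti₀ (angularSpeed_pos s t) (Real.sqrt_le_sqrt ?_)
        nlinarith [Real.cos_sq_le_one t, sq_nonneg s])
    simpa [travelTime] using h
  have h2 : 0 ≤ Real.pi * (√(1 + s ^ 2))⁻¹ := by positivity
  have h3 := pow_le_pow_left₀ h2 h1 2
  rw [mul_pow, inv_pow, Real.sq_sqrt (by positivity)] at h3
  calc Real.pi ^ 2 = Real.pi ^ 2 * (1 + s ^ 2)⁻¹ * (1 + s ^ 2) := by field_simp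
    _ ≤ travelTime s Real.pi ^ 2 * (1 + 2 * s ^ 2) := by
      gcongr
      nlinarith [sq_nonneg s]

/-- The half period times the modulus is unbounded: near the angle `π / 2` the speed is at most
`1 + s t` at distance `t`, whose reciprocal integrates to a logarithm. -/
theorem log_le_mul_travelTime {s : ℝ} (hs : 0 < s) :
    Real.log (1 + s) ≤ s * travelTime s Real.pi := by
  have hcont : Continuous fun t => (angularSpeed s (t + Real.pi / 2))⁻¹ :=
    (continuous_angularSpeed_inv_right s).comp (continuous_id.add continuous_const)
  have hlog : ∫ t in (0 : ℝ)..1, s * (1 + s * t)⁻¹ = Real.log (1 + s) := by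
    have := intervalIntegral.integral_eq_sub_of_hasDerivAt (a := 0) (b := 1)
      (f := fun t => Real.log (1 + s * t)) (f' := fun t => s * (1 + s * t)⁻¹) (fun t ht => by
        rw [uIcc_of_le zero_le_one] at ht
        have hne : 1 + s * t ≠ 0 := by nlinarith [mul_nonneg hs.le ht.1]
        refine ((((hasDerivAt_id t).const_mul s).const_add 1).log hne).congr_deriv ?_
        simp [div_eq_mul_inv])
      (ContinuousOn.intervalIntegrable (by
        rw [uIcc_of_le zero_le_one]
        refine continuousOn_const.mul (ContinuousOn.inv₀ (by fun_prop) fun t ht => ?_)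
        nlinarith [mul_nonneg hs.le ht.1]))
    simpa using this
  have hle : ∫ t in (0 : ℝ)..1, s * (1 + s * t)⁻¹ ≤
      ∫ t in (0 : ℝ)..1, s * (angularSpeed s (t + Real.pi / 2))⁻¹ := by
    refine intervalIntegral.integral_mono_on zero_le_one
      (ContinuousOn.intervalIntegrable (by
        rw [uIcc_of_le zero_le_one]
        refine continuousOn_const.mul (ContinuousOn.inv₀ (by fun_prop) fun t ht => ?_)
        nlinarith [mul_nonneg hs.le ht.1]))
      ((continuous_const.mul hcont).intervalIntegrable _ _) fun t ht => ?_
    have hst := mul_nonneg hs.le ht.1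
    refine mul_le_mul_of_nonneg_left (inv_anti₀ (angularSpeed_pos _ _) ?_) hs.le
    rw [angularSpeed, Real.cos_add_pi_div_two]
    refine Real.sqrt_le_iff.2 ⟨by linarith, ?_⟩
    have : Real.sin t ^ 2 ≤ t ^ 2 := Real.sin_sq_le_sq
    nlinarith [mul_le_mul_of_nonneg_left this (sq_nonneg s)]
  rw [hlog, intervalIntegral.integral_const_mul] at hle
  refine hle.trans (mul_le_mul_of_nonneg_left ?_ hs.le)
  rw [intervalIntegral.integral_comp_add_right (fun t => (angularSpeed s t)⁻¹), zero_add]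
  have hI := fun a b => (continuous_angularSpeed_inv_right s).intervalIntegrable
    (μ := MeasureTheory.volume) a b
  have hpi := Real.pi_gt_three
  refine intervalIntegral.integral_mono_interval (by linarith) (by linarith) (by linarith)
    (Eventually.of_forall fun t => (inv_pos.2 (angularSpeed_pos s t)).le) (hI _ _)

theorem tendsto_levelFactor_atTop : Tendsto levelFactor atTop atTop := by
  have h1 : Tendsto (fun s : ℝ => Real.log (1 + s) ^ 2) atTop atTop :=
    (tendsto_pow_atTop two_ne_zero).comp
      (Real.tendsto_log_atTop.comp (tendsto_atTop_add_const_left _ 1 tendsto_id))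
  refine tendsto_atTop_mono' _ ?_ h1
  filter_upwards [eventually_gt_atTop 0] with s hs
  have h2 := pow_le_pow_left₀ (Real.log_nonneg (by linarith)) (log_le_mul_travelTime hs) 2
  unfold levelFactor
  nlinarith [sq_nonneg (s * travelTime s Real.pi), sq_nonneg (travelTime s Real.pi)]

theorem exists_bound_of_levelFactor_le (C : ℝ) : ∃ R, ∀ s, levelFactor s ≤ C → |s| ≤ R := by
  obtain ⟨R, hR⟩ := (tendsto_levelFactor_atTop.eventually_gt_atTop C).exists_forall_of_atTop
  refine ⟨R, fun s hs => ?_⟩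
  by_contra! h
  have := hR |s| h.le
  rcases abs_cases s with ⟨h', _⟩ | ⟨h', _⟩ <;> rw [h'] at this
  · linarith
  · rw [levelFactor_neg] at this; linarith

theorem exists_levelFactor_eq {C : ℝ} (hC : Real.pi ^ 2 < C) : ∃ s, 0 < s ∧ levelFactor s = C := by
  obtain ⟨R, hR0, hR⟩ := ((eventually_gt_atTop 0).and
    (tendsto_levelFactor_atTop.eventually_gt_atTop C)).exists
  obtain ⟨s, hs, h⟩ := intermediate_value_Ioo hR0.le continuous_levelFactor.continuousOn
    ⟨by rwa [levelFactor_zero], hR⟩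
  exact ⟨s, hs.1, h⟩

/-! ### The cubic equation on a closed interval -/

section

/-- `f`, with derivative `f'`, solves `f'' = (b |f|² - μ) f` on the closed interval `[0, L]`. The
derivatives at the endpoints are two-sided derivatives of `f` as a function on the line. -/
structure IsCubicSolution {𝕜 : Type*} [RCLike 𝕜] (b μ L : ℝ) (f f' : ℝ → 𝕜) : Prop where
  hasDerivAt : ∀ x ∈ Icc 0 L, HasDerivAt f (f' x) x
  hasDerivAt_deriv : ∀ x ∈ Icc 0 L, HasDerivAt f' ((b * ‖f x‖ ^ 2 - μ) • f x) x

variable {𝕜 : Type*} [RCLike 𝕜] {b μ L : ℝ}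

theorem continuous_cubic (b μ : ℝ) : Continuous fun z : 𝕜 => (b * ‖z‖ ^ 2 - μ) • z := by
  fun_prop

theorem exists_eq_add_smul_of_deriv_deriv_eq_zero {E : Type*} [NormedAddCommGroup E]
    [NormedSpace ℝ E] (hL : 0 < L) {d d' : ℝ → E} (hc : ContinuousOn d (Icc 0 L))
    (hd : ∀ x ∈ Ioo 0 L, HasDerivAt d (d' x) x) (hd' : ∀ x ∈ Ioo 0 L, HasDerivAt d' 0 x) :
    ∃ p : E, ∀ x ∈ Icc 0 L, d x = d 0 + x • p := by
  obtain ⟨p, hp⟩ : ∃ p, ∀ x ∈ Ioo 0 L, d' x = p := by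
    refine ⟨d' (L / 2), fun x hx => ?_⟩
    exact isOpen_Ioo.is_const_of_deriv_eq_zero isPreconnected_Ioo
      (fun y hy => (hd' y hy).differentiableAt.differentiableWithinAt)
      (fun y hy => (hd' y hy).deriv) hx ⟨by linarith, by linarith⟩
  refine ⟨p, ?_⟩
  obtain ⟨q, hq⟩ : ∃ q, ∀ x ∈ Ioo 0 L, d x - x • p = q := by
    refine ⟨d (L / 2) - (L / 2) • p, fun x hx => ?_⟩
    have key : ∀ y ∈ Ioo 0 L, HasDerivAt (fun x => d x - x • p) 0 y := fun y hy => by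
      have h := (hd y hy).sub ((hasDerivAt_id y).smul_const p)
      rw [hp y hy, one_smul, sub_self] at h
      exact h
    exact isOpen_Ioo.is_const_of_deriv_eq_zero (f := fun x => d x - x • p) isPreconnected_Ioo
      (fun y hy => (key y hy).differentiableAt.differentiableWithinAt)
      (fun y hy => (key y hy).deriv) hx ⟨by linarith, by linarith⟩
  have hq' : ∀ x ∈ Icc 0 L, d x - x • p = q := by
    rw [← closure_Ioo hL.ne]
    refine EqOn.of_subset_closure (s := Ioo 0 L) (t := Icc 0 L) (f := fun x => d x - x • p)
      (g := fun _ => q) hq (by fun_prop) continuousOn_const Ioo_subset_Icc_self ?_ |>.mono ?_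
    · rw [closure_Ioo hL.ne]
    · rw [closure_Ioo hL.ne]
  intro x hx
  have h0 := hq' 0 ⟨le_rfl, hL.le⟩
  rw [zero_smul, sub_zero] at h0
  rw [h0, ← hq' x hx]
  abel

/-- A solution in the open interval that is continuous up to the endpoints is the restriction of a
solution on the closed interval: the right-hand side of the equation is continuous on `[0, L]`, and
its double primitive differs from `f` by an affine function. -/
theorem exists_isCubicSolution (hL : 0 < L) {f : ℝ → 𝕜} (hc : ContinuousOn f (Icc 0 L))
    (hf : ContDiffOn ℝ 2 f (Ioo 0 L))
    (heq : ∀ x ∈ Ioo 0 L, deriv (deriv f) x = (b * ‖f x‖ ^ 2 - μ) • f x) (h0 : f 0 = 0) :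
    ∃ h h' : ℝ → 𝕜, IsCubicSolution b μ L h h' ∧ ∀ x ∈ Icc 0 L, h x = f x := by
  -- `F` extends the second derivative to a continuous function on the line
  set F : ℝ → 𝕜 := IccExtend hL.le (fun x : Icc 0 L => (b * ‖f x‖ ^ 2 - μ) • f x) with hF
  have hFc : Continuous F :=
    ((continuous_cubic b μ).comp (continuousOn_iff_continuous_domRestrict.1 hc)).Icc_extend'
  have hFx : ∀ x ∈ Icc 0 L, F x = (b * ‖f x‖ ^ 2 - μ) • f x := fun x hx =>
    IccExtend_of_mem hL.le _ hx
  set G : ℝ → 𝕜 := fun x => ∫ t in (0 : ℝ)..x, F t with hG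
  have hGd : ∀ x, HasDerivAt G (F x) x := fun x =>
    (hFc.integral_hasStrictDerivAt 0 x).hasDerivAt
  have hGc : Continuous G := continuous_iff_continuousAt.2 fun x => (hGd x).continuousAt
  set H : ℝ → 𝕜 := fun x => ∫ t in (0 : ℝ)..x, G t with hH
  have hHd : ∀ x, HasDerivAt H (G x) x := fun x =>
    (hGc.integral_hasStrictDerivAt 0 x).hasDerivAt
  have hHc : Continuous H := continuous_iff_continuousAt.2 fun x => (hHd x).continuousAt
  have hf1 : ∀ x ∈ Ioo 0 L, HasDerivAt f (deriv f x) x := fun x hx =>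
    ((hf.differentiableOn two_ne_zero x hx).differentiableAt (isOpen_Ioo.mem_nhds hx)).hasDerivAt
  have hf2 : ∀ x ∈ Ioo 0 L, HasDerivAt (deriv f) (F x) x := fun x hx => by
    have h2 : ContDiffOn ℝ 1 (deriv f) (Ioo 0 L) :=
      ((contDiffOn_succ_iff_deriv_of_isOpen (n := 1) isOpen_Ioo).1 hf).2.2
    rw [hFx x (Ioo_subset_Icc_self hx), ← heq x hx]
    exact ((h2.differentiableOn one_ne_zero x hx).differentiableAt
      (isOpen_Ioo.mem_nhds hx)).hasDerivAt
  obtain ⟨p, hp⟩ := exists_eq_add_smul_of_deriv_deriv_eq_zero hL (d := fun x => f x - H x)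
    (d' := fun x => deriv f x - G x) (hc.sub hHc.continuousOn)
    (fun x hx => (hf1 x hx).sub (hHd x))
    (fun x hx => ((hf2 x hx).sub (hGd x)).congr_deriv (sub_self _))
  have hval : ∀ x ∈ Icc 0 L, H x + x • p = f x := fun x hx => by
    have h1 := hp x hx
    have hH0 : H 0 = 0 := by simp [hH]
    simp only [h0, hH0, sub_zero, zero_add] at h1
    rw [← h1]; abel
  refine ⟨fun x => H x + x • p, fun x => G x + p, ⟨fun x _ => ?_, fun x hx => ?_⟩, hval⟩
  · exact ((hHd x).add ((hasDerivAt_id x).smul_const p)).congr_deriv (by rw [one_smul])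
  · simp only [hval x hx]
    rw [← hFx x hx]
    exact (hGd x).add_const p

namespace IsCubicSolution

theorem continuousOn {f f' : ℝ → 𝕜} (hf : IsCubicSolution b μ L f f') :
    ContinuousOn f (Icc 0 L) := fun x hx => (hf.hasDerivAt x hx).continuousAt.continuousWithinAt

theorem continuousOn_deriv {f f' : ℝ → 𝕜} (hf : IsCubicSolution b μ L f f') :
    ContinuousOn f' (Icc 0 L) :=
  fun x hx => (hf.hasDerivAt_deriv x hx).continuousAt.continuousWithinAt

theorem norm_cubic_sub_le {z w : 𝕜} {R : ℝ} (hz : ‖z‖ ≤ R) (hw : ‖w‖ ≤ R) :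
    ‖(b * ‖z‖ ^ 2 - μ) • z - (b * ‖w‖ ^ 2 - μ) • w‖ ≤ (3 * |b| * R ^ 2 + |μ|) * ‖z - w‖ := by
  have hR : 0 ≤ R := (norm_nonneg z).trans hz
  have h1 : (b * ‖z‖ ^ 2 - μ) • z - (b * ‖w‖ ^ 2 - μ) • w =
      (b * ‖z‖ ^ 2 - μ) • (z - w) + (b * ((‖z‖ + ‖w‖) * (‖z‖ - ‖w‖))) • w := by
    module
  have h2 : |b * ‖z‖ ^ 2 - μ| ≤ |b| * R ^ 2 + |μ| := by
    refine (abs_sub _ _).trans ?_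
    rw [abs_mul, abs_of_nonneg (sq_nonneg ‖z‖)]
    gcongr
  have h3 : |b * ((‖z‖ + ‖w‖) * (‖z‖ - ‖w‖))| ≤ |b| * ((R + R) * ‖z - w‖) := by
    rw [abs_mul, abs_mul, abs_of_nonneg (add_nonneg (norm_nonneg z) (norm_nonneg w))]
    gcongr
    exact abs_norm_sub_norm_le z w
  rw [h1]
  refine (norm_add_le _ _).trans ?_
  rw [norm_smul, norm_smul, Real.norm_eq_abs, Real.norm_eq_abs]
  calc _ ≤ (|b| * R ^ 2 + |μ|) * ‖z - w‖ + |b| * ((R + R) * ‖z - w‖) * R := by gcongr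
    _ = _ := by ring

/-- Uniqueness for the initial value problem, from Grönwall's inequality. -/
theorem eqOn {f f' h h' : ℝ → 𝕜} (hf : IsCubicSolution b μ L f f')
    (hh : IsCubicSolution b μ L h h') (h0 : f 0 = h 0) (h0' : f' 0 = h' 0) :
    EqOn f h (Icc 0 L) := by
  obtain ⟨R1, hR1⟩ := isCompact_Icc.exists_bound_of_continuousOn hf.continuousOn
  obtain ⟨R2, hR2⟩ := isCompact_Icc.exists_bound_of_continuousOn hh.continuousOn
  set K := 3 * |b| * (max R1 R2) ^ 2 + |μ| with hK
  have hK0 : 0 ≤ K := by positivity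
  have key := eq_zero_of_abs_deriv_le_mul_abs_self_of_eq_zero_right (a := 0) (b := L) (K := 1 + K)
    (f := fun x => (f x - h x, f' x - h' x))
    (f' := fun x => (f' x - h' x, (b * ‖f x‖ ^ 2 - μ) • f x - (b * ‖h x‖ ^ 2 - μ) • h x))
    ((hf.continuousOn.sub hh.continuousOn).prodMk
      (hf.continuousOn_deriv.sub hh.continuousOn_deriv))
    (fun x hx => by
      have hx' := Ico_subset_Icc_self hx
      exact (((hf.hasDerivAt x hx').sub (hh.hasDerivAt x hx')).prodMk
        ((hf.hasDerivAt_deriv x hx').sub (hh.hasDerivAt_deriv x hx'))).hasDerivWithinAt)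
    (by simp [h0, h0'])
    (fun x hx => by
      have hx' := Ico_subset_Icc_self hx
      have h1 := norm_cubic_sub_le (b := b) (μ := μ) ((hR1 x hx').trans (le_max_left R1 R2))
        ((hR2 x hx').trans (le_max_right R1 R2))
      rw [Prod.norm_mk, Prod.norm_mk]
      have h2 := le_max_left ‖f x - h x‖ ‖f' x - h' x‖
      have h3 := le_max_right ‖f x - h x‖ ‖f' x - h' x‖
      have h4 := norm_nonneg (f x - h x)
      have h5 := mul_le_mul_of_nonneg_left h2 hK0
      have h6 : 0 ≤ K * max ‖f x - h x‖ ‖f' x - h' x‖ := mul_nonneg hK0 (h4.trans h2)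
      refine max_le ?_ ?_ <;> linarith)
  intro x hx
  exact sub_eq_zero.1 (Prod.ext_iff.1 (key x hx)).1

theorem mono {f f' : ℝ → 𝕜} (hf : IsCubicSolution b μ L f f') {l : ℝ} (hl : l ≤ L) :
    IsCubicSolution b μ l f f' :=
  ⟨fun x hx => hf.hasDerivAt x ⟨hx.1, hx.2.trans hl⟩,
    fun x hx => hf.hasDerivAt_deriv x ⟨hx.1, hx.2.trans hl⟩⟩

theorem reflect {f f' : ℝ → 𝕜} (hf : IsCubicSolution b μ L f f') :
    IsCubicSolution b μ L (fun x => f (L - x)) (fun x => -f' (L - x)) := by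
  have hm : ∀ x ∈ Icc 0 L, L - x ∈ Icc 0 L := fun x hx => ⟨by linarith [hx.2], by linarith [hx.1]⟩
  refine ⟨fun x hx => (hf.hasDerivAt _ (hm x hx)).comp_const_sub L x, fun x hx => ?_⟩
  exact ((hf.hasDerivAt_deriv _ (hm x hx)).comp_const_sub L x).neg.congr_deriv (neg_neg _)

theorem hasDerivAt_re {f : ℝ → 𝕜} {f' : 𝕜} {x : ℝ} (hf : HasDerivAt f f' x) :
    HasDerivAt (fun y => RCLike.re (f y)) (RCLike.re f') x :=
  (RCLike.reCLM (K := 𝕜)).hasFDerivAt.comp_hasDerivAt x hf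

theorem hasDerivAt_im {f : ℝ → 𝕜} {f' : 𝕜} {x : ℝ} (hf : HasDerivAt f f' x) :
    HasDerivAt (fun y => RCLike.im (f y)) (RCLike.im f') x :=
  (RCLike.imCLM (K := 𝕜)).hasFDerivAt.comp_hasDerivAt x hf

theorem eq_of_hasDerivAt_zero {u : ℝ → ℝ} (hu : ∀ x ∈ Icc 0 L, HasDerivAt u 0 x) {x : ℝ}
    (hx : x ∈ Icc 0 L) : u x = u 0 :=
  constant_of_has_deriv_right_zero
    (fun y hy => (hu y hy).continuousAt.continuousWithinAt)
    (fun y hy => (hu y (Ico_subset_Icc_self hy)).hasDerivWithinAt) x hx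

/-! ### Conserved quantities and the amplitude -/

/-- Conservation of energy, for a solution starting at `0`. -/
theorem energy {f f' : ℝ → 𝕜} (hf : IsCubicSolution b μ L f f') (h0 : f 0 = 0) {x : ℝ}
    (hx : x ∈ Icc 0 L) :
    ‖f' x‖ ^ 2 + μ * ‖f x‖ ^ 2 - b / 2 * ‖f x‖ ^ 4 = ‖f' 0‖ ^ 2 := by
  have key := eq_of_hasDerivAt_zero (L := L)
    (u := fun y => ‖f' y‖ ^ 2 + μ * ‖f y‖ ^ 2 - b / 2 * (‖f y‖ ^ 2 * ‖f y‖ ^ 2)) (fun y hy => by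
      have h1 := hasDerivAt_re (hf.hasDerivAt y hy)
      have h2 := hasDerivAt_im (hf.hasDerivAt y hy)
      have h3 := hasDerivAt_re (hf.hasDerivAt_deriv y hy)
      have h4 := hasDerivAt_im (hf.hasDerivAt_deriv y hy)
      have hn := (h1.mul h1).add (h2.mul h2)
      have h := (((h3.mul h3).add (h4.mul h4)).add (hn.const_mul μ)).sub
        ((hn.mul hn).const_mul (b / 2))
      simp only [RCLike.norm_sq_eq_def]
      refine h.congr_deriv ?_
      simp only [RCLike.smul_re, RCLike.smul_im, Pi.add_apply, Pi.mul_apply,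
        RCLike.norm_sq_eq_def]
      ring) hx
  simp only [h0, norm_zero] at key
  linear_combination key

/-- Conservation of angular momentum: it vanishes for a solution starting at `0`. -/
theorem re_mul_im_deriv {f f' : ℝ → 𝕜} (hf : IsCubicSolution b μ L f f') (h0 : f 0 = 0) {x : ℝ}
    (hx : x ∈ Icc 0 L) :
    RCLike.re (f x) * RCLike.im (f' x) - RCLike.im (f x) * RCLike.re (f' x) = 0 := by
  have key := eq_of_hasDerivAt_zero (L := L)
    (u := fun y => RCLike.re (f y) * RCLike.im (f' y) - RCLike.im (f y) * RCLike.re (f' y))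
    (fun y hy => by
      have h1 := hasDerivAt_re (hf.hasDerivAt y hy)
      have h2 := hasDerivAt_im (hf.hasDerivAt y hy)
      have h3 := hasDerivAt_re (hf.hasDerivAt_deriv y hy)
      have h4 := hasDerivAt_im (hf.hasDerivAt_deriv y hy)
      refine ((h1.mul h4).sub (h2.mul h3)).congr_deriv ?_
      simp only [RCLike.smul_re, RCLike.smul_im]
      ring) hx
  simpa [h0] using key

/-- At a local maximum of `|f|` the radial part of `f'` vanishes, and the angular part vanishes because
the angular momentum does. -/
theorem deriv_eq_zero_of_isLocalMax {f f' : ℝ → 𝕜} (hf : IsCubicSolution b μ L f f')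
    (h0 : f 0 = 0) {x : ℝ} (hx : x ∈ Icc 0 L) (hmax : IsLocalMax (fun y => ‖f y‖ ^ 2) x)
    (hne : f x ≠ 0) : f' x = 0 := by
  have h1 := hasDerivAt_re (hf.hasDerivAt x hx)
  have h2 := hasDerivAt_im (hf.hasDerivAt x hx)
  have hrad := hmax.hasDerivAt_eq_zero (by
    simp only [RCLike.norm_sq_eq_def]
    exact (h1.mul h1).add (h2.mul h2))
  have hang := hf.re_mul_im_deriv h0 hx
  -- Lagrange's identity `|z|² |w|² = (Re z Re w + Im z Im w)² + (Re z Im w - Im z Re w)²`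
  have hprod : ‖f x‖ ^ 2 * ‖f' x‖ ^ 2 = 0 := by
    rw [RCLike.norm_sq_eq_def, RCLike.norm_sq_eq_def]
    linear_combination (1 / 4 * (RCLike.re (f' x) * RCLike.re (f x) +
      RCLike.re (f x) * RCLike.re (f' x) + (RCLike.im (f' x) * RCLike.im (f x) +
      RCLike.im (f x) * RCLike.im (f' x)))) * hrad +
      (RCLike.re (f x) * RCLike.im (f' x) - RCLike.im (f x) * RCLike.re (f' x)) * hang
  rcases mul_eq_zero.1 hprod with h | h
  · exact absurd (norm_eq_zero.1 (pow_eq_zero_iff two_ne_zero |>.1 h)) hne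
  · exact norm_eq_zero.1 (pow_eq_zero_iff two_ne_zero |>.1 h)

theorem const {z : 𝕜} (hz : b * ‖z‖ ^ 2 = μ) :
    IsCubicSolution b μ L (fun _ => z) (fun _ => 0) :=
  ⟨fun x _ => hasDerivAt_const x z, fun x _ => by
    simpa [hz] using hasDerivAt_const x (0 : 𝕜)⟩

theorem zero : IsCubicSolution b μ L (fun _ => (0 : 𝕜)) (fun _ => 0) :=
  ⟨fun x _ => hasDerivAt_const x 0, fun x _ => by
    simpa using hasDerivAt_const x (0 : 𝕜)⟩

/-- The amplitude `M = max |f|` of a nontrivial Dirichlet solution lies strictly below the equilibrium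
value `√(μ / b)`, and the energy identity expresses the initial speed through it. -/
theorem exists_amplitude {f f' : ℝ → 𝕜} (hf : IsCubicSolution b μ L f f') (hL : 0 < L)
    (hb : 0 ≤ b) (h0 : f 0 = 0) (h1 : f L = 0) (hne : ∃ x ∈ Icc 0 L, f x ≠ 0) :
    ∃ M : ℝ, 0 < M ∧ b * M ^ 2 < μ ∧ f' 0 ≠ 0 ∧
      ‖f' 0‖ ^ 2 = M ^ 2 * (μ - b / 2 * M ^ 2) := by
  have hp : f' 0 ≠ 0 := fun hp => by
    obtain ⟨x, hx, hfx⟩ := hne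
    exact hfx (hf.eqOn zero h0 hp hx)
  have hnc : ContinuousOn (fun y => ‖f y‖ ^ 2) (Icc 0 L) := hf.continuousOn.norm.pow 2
  obtain ⟨x₀, hx₀, hmax⟩ := isCompact_Icc.exists_isMaxOn (nonempty_Icc.2 hL.le) hnc
  have hfx₀ : f x₀ ≠ 0 := fun h => by
    obtain ⟨x, hx, hfx⟩ := hne
    have := hmax hx
    simp only [mem_ofPred_eq, h, norm_zero] at this
    have : 0 < ‖f x‖ ^ 2 := by positivity
    linarith
  have hpos : 0 < x₀ := lt_of_le_of_ne hx₀.1 fun h => hfx₀ (h ▸ h0)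
  have hlt : x₀ < L := lt_of_le_of_ne hx₀.2 fun h => hfx₀ (h ▸ h1)
  have hf'x₀ := hf.deriv_eq_zero_of_isLocalMax h0 hx₀
    (hmax.isLocalMax (Icc_mem_nhds hpos hlt)) hfx₀
  have hM : 0 < ‖f x₀‖ := norm_pos_iff.2 hfx₀
  have hE := hf.energy h0 hx₀
  rw [hf'x₀, norm_zero] at hE
  have hp2 : 0 < ‖f' 0‖ ^ 2 := by positivity
  have hμ : 0 < μ := by
    have : 0 < μ * ‖f x₀‖ ^ 2 := by nlinarith [mul_nonneg hb (pow_nonneg hM.le 4)]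
    exact pos_of_mul_pos_left this (by positivity)
  refine ⟨‖f x₀‖, hM, ?_, hp, by linear_combination -hE⟩
  by_contra! hge
  rcases hge.eq_or_lt with heq | hgt
  · -- the constant solution through the maximum would have to vanish at the left endpoint
    have hr := (hf.mono hlt.le).reflect
    have := hr.eqOn (const (L := x₀) heq.symm) (by simp) (by simp [hf'x₀])
      (right_mem_Icc.2 hpos.le)
    simp only [sub_self, h0] at this
    exact hfx₀ this.symm
  · -- at a point with `b * ‖f‖ ^ 2 = μ` the energy identity makes `‖f'‖ ^ 2` negative
    obtain ⟨y, hy, hfy⟩ := intermediate_value_Icc (f := fun y => b * ‖f y‖ ^ 2) hpos.le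
      (continuousOn_const.mul (hnc.mono (Icc_subset_Icc_right hlt.le)))
      ⟨by simp [h0, hμ.le], hgt.le⟩
    have hEy := hf.energy h0 ⟨hy.1, hy.2.trans hlt.le⟩
    simp only at hfy
    have hb' : 0 < b := lt_of_le_of_ne hb fun h => by rw [← h] at hgt; linarith
    have : b * ‖f' y‖ ^ 2 = -(1 / 2) * (b * ‖f x₀‖ ^ 2 - μ) ^ 2 := by
      linear_combination b * hEy - b * hE + (b / 2 * ‖f y‖ ^ 2 - μ / 2) * hfy
    have h5 : 0 < (b * ‖f x₀‖ ^ 2 - μ) ^ 2 := by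
      have := sub_pos.2 hgt
      positivity
    nlinarith [mul_nonneg hb (sq_nonneg ‖f' y‖)]

end IsCubicSolution

/-! ### Classification of the Dirichlet solutions -/

/-- Rescaled standing waves, times a constant `c`, solve the cubic equation if amplitude and frequency
match `b` and `μ`. -/
theorem isCubicSolution_wave (s ω a : ℝ) (c : 𝕜) (hb : b * (a * ‖c‖) ^ 2 = 2 * (s * ω) ^ 2)
    (hμ : μ = ω ^ 2 * (1 + 2 * s ^ 2)) :
    IsCubicSolution b μ L (fun x => (a * wave s (ω * x)) • c)
      (fun x => (a * (ω * waveDeriv s (ω * x))) • c) := by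
  have hl : ∀ x, HasDerivAt (fun x => ω * x) ω x := fun x => by
    simpa using (hasDerivAt_id x).const_mul ω
  constructor
  · intro x _
    refine ((((hasDerivAt_wave s (ω * x)).comp x (hl x)).const_mul a).smul_const c).congr_deriv ?_
    congr 1; ring
  · intro x _
    have h := (((hasDerivAt_waveDeriv s (ω * x)).comp x (hl x)).const_mul ω).const_mul a
    refine (h.smul_const c).congr_deriv ?_
    rw [norm_smul, mul_pow, Real.norm_eq_abs, sq_abs, smul_smul]
    congr 1
    rw [hμ]
    linear_combination (-a * wave s (ω * x) ^ 3) * hb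

/-- Every nontrivial Dirichlet solution is a constant of modulus one times a standing wave with a whole
number `k` of half waves. The case `b = 0` is allowed; it gives `s = 0` and hence the linear
eigenfunctions. -/
theorem IsCubicSolution.exists_wave {f f' : ℝ → 𝕜} (hf : IsCubicSolution b μ L f f') (hL : 0 < L)
    (hb : 0 ≤ b) (h0 : f 0 = 0) (h1 : f L = 0) (hne : ∃ x ∈ Icc 0 L, f x ≠ 0) :
    ∃ (k : ℕ+) (s a : ℝ) (c : 𝕜), ‖c‖ = 1 ∧ 0 ≤ s ∧ 0 < a ∧
      b * a ^ 2 = 2 * (s * (k * travelTime s Real.pi / L)) ^ 2 ∧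
      μ = (k * travelTime s Real.pi / L) ^ 2 * (1 + 2 * s ^ 2) ∧
      ∀ x ∈ Icc 0 L, f x = (a * wave s (k * travelTime s Real.pi / L * x)) • c := by
  obtain ⟨M, hM, hMμ, hp, hpM⟩ := hf.exists_amplitude hL hb h0 h1 hne
  -- the frequency and the modulus are read off from `μ = ω² (1 + 2 s²)`, `b M² = 2 s² ω²`
  have hω2 : 0 < μ - b * M ^ 2 := sub_pos.2 hMμ
  set ω := √(μ - b * M ^ 2) with hω
  have hωpos : 0 < ω := Real.sqrt_pos.2 hω2
  have hωsq : ω ^ 2 = μ - b * M ^ 2 := Real.sq_sqrt hω2.le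
  set s := √(b / 2) * M / ω with hs
  have hsω : s * ω = √(b / 2) * M := div_mul_cancel₀ _ hωpos.ne'
  have hsω2 : (s * ω) ^ 2 = b / 2 * M ^ 2 := by
    rw [hsω, mul_pow, Real.sq_sqrt (by positivity)]
  have hs0 : 0 ≤ s := by positivity
  have hn : 0 < ‖f' 0‖ := norm_pos_iff.2 hp
  -- the direction of the initial velocity is the phase of the solution
  set c : 𝕜 := (‖f' 0‖⁻¹) • f' 0 with hc
  have hcn : ‖c‖ = 1 := by
    rw [hc, norm_smul, norm_inv, norm_norm, inv_mul_cancel₀ hn.ne']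
  have hbM : b * M ^ 2 = 2 * (s * ω) ^ 2 := by rw [hsω2]; ring
  have hμω : μ = ω ^ 2 * (1 + 2 * s ^ 2) := by linear_combination hbM - hωsq
  have hpω : ‖f' 0‖ = M * (ω * √(1 + s ^ 2)) := by
    rw [← sq_eq_sq₀ hn.le (by positivity), mul_pow, mul_pow,
      Real.sq_sqrt (show 0 ≤ 1 + s ^ 2 by positivity), hpM]
    linear_combination M ^ 2 * (hμω) - M ^ 2 / 2 * hbM
  have heq := hf.eqOn (isCubicSolution_wave s ω M c (by rw [hcn, mul_one, hbM]) hμω)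
    (by simp [h0, wave_zero]) (by
      rw [mul_zero, waveDeriv_zero, ← hpω, hc, smul_smul, mul_inv_cancel₀ hn.ne', one_smul])
  have hL0 := heq (right_mem_Icc.2 hL.le)
  simp only [h1] at hL0
  have hc0 : c ≠ 0 := norm_ne_zero_iff.1 (by rw [hcn]; exact one_ne_zero)
  have hw : wave s (ω * L) = 0 := by
    have := (smul_eq_zero.1 hL0.symm).resolve_right hc0
    exact (mul_eq_zero.1 this).resolve_left hM.ne'
  obtain ⟨k, hk⟩ := exists_nat_of_wave_eq_zero (mul_pos hωpos hL) hw
  have hωk : ω = k * travelTime s Real.pi / L := by rw [← hk]; field_simp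
  refine ⟨k, s, M, c, hcn, hs0, hM, ?_⟩
  rw [← hωk]
  exact ⟨hbM, hμω, heq⟩

namespace IsCubicSolution

theorem deriv_deriv {f f' : ℝ → 𝕜} (hf : IsCubicSolution b μ L f f') {x : ℝ} (hx : x ∈ Ioo 0 L) :
    deriv (deriv f) x = (b * ‖f x‖ ^ 2 - μ) • f x := by
  have h : deriv f =ᶠ[𝓝 x] f' := by
    filter_upwards [isOpen_Ioo.mem_nhds hx] with y hy
    exact (hf.hasDerivAt y (Ioo_subset_Icc_self hy)).deriv
  rw [h.deriv_eq]
  exact (hf.hasDerivAt_deriv x (Ioo_subset_Icc_self hx)).deriv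

theorem contDiffOn {f f' : ℝ → 𝕜} (hf : IsCubicSolution b μ L f f') :
    ContDiffOn ℝ 2 f (Ioo 0 L) := by
  have h2 : ContinuousOn (deriv (deriv f)) (Ioo 0 L) :=
    ((continuous_cubic b μ).comp_continuousOn
      (hf.continuousOn.mono Ioo_subset_Icc_self)).congr fun x hx => hf.deriv_deriv hx
  have hd : EqOn (deriv f) f' (Ioo 0 L) := fun y hy =>
    (hf.hasDerivAt y (Ioo_subset_Icc_self hy)).deriv
  refine (contDiffOn_succ_iff_deriv_of_isOpen (n := 1) isOpen_Ioo).2 ⟨fun x hx =>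
    (hf.hasDerivAt x (Ioo_subset_Icc_self hx)).differentiableAt.differentiableWithinAt,
    by simp, ?_⟩
  refine (contDiffOn_succ_iff_deriv_of_isOpen (n := 0) isOpen_Ioo).2 ⟨fun x hx =>
    ((hf.hasDerivAt_deriv x (Ioo_subset_Icc_self hx)).differentiableAt.differentiableWithinAt).congr
      hd (hd hx), by simp, ?_⟩
  exact contDiffOn_zero.2 h2

/-- Back to the original parameters: `b = g / A` and `μ = (ħ λ - β) / A` with `A = ħ² / (4 m)`. -/
theorem isSolution {hbar m lam g β : ℝ} (hhbar : 0 < hbar) (hm : 0 < m) {f f' : ℝ → 𝕜}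
    (hf : IsCubicSolution (g / (hbar ^ 2 / (4 * m))) ((hbar * lam - β) / (hbar ^ 2 / (4 * m))) L f f')
    (h0 : f 0 = 0) (h1 : f L = 0) : IsSolution hbar m lam g L β f where
  continuousOn := hf.continuousOn
  contDiffOn := hf.contDiffOn
  equation x hx := by
    rw [hf.deriv_deriv hx]
    have hA : hbar ^ 2 / (4 * m) ≠ 0 := by positivity
    generalize hbar ^ 2 / (4 * m) = A at *
    rw [smul_smul, smul_smul, ← neg_smul, ← add_smul, ← add_smul]
    convert zero_smul ℝ (f x)
    field_simp
    ring
  left := h0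
  right := h1

end IsCubicSolution

theorem IsSolution.exists_isCubicSolution {hbar m lam g L β : ℝ} (hhbar : 0 < hbar) (hm : 0 < m)
    (hL : 0 < L) {f : ℝ → 𝕜} (hf : IsSolution hbar m lam g L β f) :
    ∃ h h' : ℝ → 𝕜, IsCubicSolution (g / (hbar ^ 2 / (4 * m)))
      ((hbar * lam - β) / (hbar ^ 2 / (4 * m))) L h h' ∧ ∀ x ∈ Icc 0 L, h x = f x := by
  refine BEC.exists_isCubicSolution hL hf.continuousOn hf.contDiffOn (fun x hx => ?_) hf.left
  have h := hf.equation x hx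
  have hA : hbar ^ 2 / (4 * m) ≠ 0 := by positivity
  generalize hbar ^ 2 / (4 * m) = A at *
  rw [smul_smul, add_assoc, ← add_smul, neg_add_eq_zero] at h
  rw [← inv_smul_smul₀ hA (deriv (deriv f) x), h, smul_smul]
  congr 1
  field_simp
  ring

/-! ### The Dirichlet spectrum -/

theorem isDirichletEigenvalue_iff {L μ : ℝ} (hL : 0 < L) :
    IsDirichletEigenvalue L μ ↔ ∃ k : ℕ+, ((k : ℝ) * Real.pi / L) ^ 2 = μ := by
  constructor
  · rintro ⟨e, hc, hd, heq, h0, h1, hne⟩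
    obtain ⟨h, h', hh, hhe⟩ := exists_isCubicSolution (b := 0) (μ := μ) hL hc hd
      (fun x hx => by
        rw [zero_mul, zero_sub, neg_smul, smul_eq_mul, ← heq x hx, neg_neg]) h0
    obtain ⟨k, s, a, c, -, -, -, hs, hμ, -⟩ := hh.exists_wave hL le_rfl
      (by rw [hhe _ (left_mem_Icc.2 hL.le), h0]) (by rw [hhe _ (right_mem_Icc.2 hL.le), h1])
      (by
        obtain ⟨x, hx, hex⟩ := hne
        exact ⟨x, hx, by rwa [hhe x hx]⟩)
    have hT := travelTime_pi_pos s
    have hω : (k : ℝ) * travelTime s Real.pi / L ≠ 0 := by positivity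
    have hs0 : s = 0 := by
      rw [zero_mul, eq_comm, mul_eq_zero, pow_eq_zero_iff two_ne_zero, mul_eq_zero] at hs
      simpa [hω] using hs
    refine ⟨k, ?_⟩
    rw [hμ, hs0, travelTime_zero_left]
    ring
  · rintro ⟨k, rfl⟩
    set ω := (k : ℝ) * Real.pi / L with hω
    have hs := isCubicSolution_wave (𝕜 := ℝ) (b := 0) (L := L) 0 ω 1 1 (by simp) rfl
    have hkL : ω * L = k * travelTime 0 Real.pi := by
      rw [travelTime_zero_left, hω]; field_simp
    refine ⟨_, hs.continuousOn, hs.contDiffOn, fun x hx => ?_, ?_, ?_, L / (2 * k), ?_, ?_⟩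
    · rw [hs.deriv_deriv hx]
      simp
    · simp [wave_zero]
    · simp [hkL, wave_nat_mul]
    · refine ⟨by positivity, div_le_self hL.le ?_⟩
      have : (1 : ℝ) ≤ k := by exact_mod_cast one_le (a := k)
      linarith
    · have h2 : ω * (L / (2 * k)) = Real.pi / 2 := by rw [hω]; field_simp
      have := wave_pos (s := 0) (u := Real.pi / 2) (by positivity)
        (by rw [travelTime_zero_left]; linarith [Real.pi_pos])
      simp only [h2, one_mul, smul_eq_mul, mul_one]
      exact this.ne'

theorem IsDirichletSpectrum.eq {L : ℝ} (hL : 0 < L) {ξ : ℕ+ → ℝ} (hξ : IsDirichletSpectrum L ξ)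
    (k : ℕ+) : ξ k = ((k : ℝ) * Real.pi / L) ^ 2 := by
  have hmono : StrictMono fun k : ℕ+ => ((k : ℝ) * Real.pi / L) ^ 2 := fun i j hij => by
    have : (i : ℝ) < j := by exact_mod_cast hij
    have := Real.pi_pos
    dsimp only
    gcongr
  refine congrFun ((hξ.strictMono.range_inj hmono).1 ?_) k
  rw [hξ.range_eq]
  ext μ
  exact isDirichletEigenvalue_iff hL

end

variable {𝕜 : Type*} [RCLike 𝕜]

/-! ### The sheets of solutions -/

/-- The frequency for which the standing wave of modulus `s` has `k` half waves on `[0, L]`. -/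
noncomputable def frequency (L : ℝ) (k : ℕ+) (s : ℝ) : ℝ := k * travelTime s Real.pi / L

/-- The solution with `k` half waves, modulus `s = p.1` and phase factor `p.2`; the sign of `s` is the
sign of the real profile, and `s = 0` gives the zero function. -/
noncomputable def sheetProfile (κ L : ℝ) (k : ℕ+) (p : ℝ × 𝕜) (x : ℝ) : 𝕜 :=
  (κ * (p.1 * frequency L k p.1) * wave p.1 (frequency L k p.1 * x)) • p.2

theorem continuous_sheetProfile (κ L : ℝ) (k : ℕ+) :
    Continuous fun q : (ℝ × 𝕜) × ℝ => sheetProfile κ L k q.1 q.2 := by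
  have h := continuous_travelTime_left Real.pi
  have hw := continuous_wave
  have hω : Continuous (frequency L k) := by unfold frequency; fun_prop
  unfold sheetProfile
  have h2 : Continuous fun q : (ℝ × 𝕜) × ℝ => wave q.1.1 (frequency L k q.1.1 * q.2) :=
    hw.comp (f := fun q : (ℝ × 𝕜) × ℝ => (q.1.1, frequency L k q.1.1 * q.2)) (by fun_prop)
  fun_prop

/-- The factor `√(2 / b)`, `b = 4 m g / ħ²`, between `s ω` and the amplitude of a solution of modulus
`s` and frequency `ω`. -/
noncomputable def scale (hbar m g : ℝ) : ℝ := √(2 * (hbar ^ 2 / (4 * m)) / g)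

theorem scale_pos {hbar m g : ℝ} (hhbar : 0 < hbar) (hm : 0 < m) (hg : 0 < g) :
    0 < scale hbar m g := Real.sqrt_pos.2 (by positivity)

theorem scale_sq {hbar m g : ℝ} (hhbar : 0 < hbar) (hm : 0 < m) (hg : 0 < g) :
    scale hbar m g ^ 2 = 2 * (hbar ^ 2 / (4 * m)) / g := Real.sq_sqrt (by positivity)

/-- The pair of parameter value `β` and solution with `k` half waves, modulus `p.1` and phase factor
`p.2`. -/
noncomputable def sheetPoint (hbar m lam g L : ℝ) (k : ℕ+) (p : ℝ × 𝕜) :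
    ℝ × C(Icc (0 : ℝ) L, 𝕜) :=
  (hbar * lam - hbar ^ 2 / (4 * m) * ((k / L) ^ 2 * levelFactor p.1),
    ⟨fun x => sheetProfile (scale hbar m g) L k p x,
      (continuous_sheetProfile _ L k).comp (continuous_const.prodMk continuous_subtype_val)⟩)

/-- All solutions with `k` half waves, together with the bifurcation point, at which the modulus is
zero. The phase factor runs over the unit sphere of `𝕜`, so that the sheet is a curve for real
scalars and a surface for complex ones. -/
def sheet (𝕜 : Type*) [RCLike 𝕜] (hbar m lam g L : ℝ) (k : ℕ+) :
    Set (ℝ × C(Icc (0 : ℝ) L, 𝕜)) :=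
  sheetPoint hbar m lam g L k '' {p | ‖p.2‖ = 1}

section

variable {hbar m lam g L : ℝ}

theorem sheetProfile_eq_of_sheetPoint_eq {i j : ℕ+} {p q : ℝ × 𝕜}
    (h : sheetPoint hbar m lam g L i p = sheetPoint hbar m lam g L j q) {x : ℝ}
    (hx : x ∈ Icc 0 L) :
    sheetProfile (scale hbar m g) L i p x = sheetProfile (scale hbar m g) L j q x :=
  congrArg (fun r : ℝ × C(Icc (0 : ℝ) L, 𝕜) => r.2 ⟨x, hx⟩) h

theorem continuous_sheetPoint (k : ℕ+) :
    Continuous (sheetPoint hbar m lam g L k : ℝ × 𝕜 → ℝ × C(Icc (0 : ℝ) L, 𝕜)) := by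
  refine Continuous.prodMk ?_ (ContinuousMap.continuous_of_continuous_uncurry _ ?_)
  · have := continuous_levelFactor
    fun_prop
  · exact (continuous_sheetProfile _ L k).comp
      (f := fun q : (ℝ × 𝕜) × Icc (0 : ℝ) L => (q.1, (q.2 : ℝ))) (by fun_prop)

theorem frequency_pos (hL : 0 < L) (k : ℕ+) (s : ℝ) : 0 < frequency L k s := by
  have := travelTime_pi_pos s
  unfold frequency
  positivity

theorem frequency_mul_sq (k : ℕ+) (s : ℝ) :
    (k / L) ^ 2 * levelFactor s = frequency L k s ^ 2 * (1 + 2 * s ^ 2) := by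
  unfold levelFactor frequency
  ring

theorem sheetPoint_zero (k : ℕ+) (c : 𝕜) :
    sheetPoint hbar m lam g L k (0, c) =
      (criticalValue hbar m lam ((k * Real.pi / L) ^ 2), 0) := by
  refine Prod.ext ?_ ?_
  · simp only [sheetPoint, levelFactor_zero, criticalValue]
    ring
  · ext x
    simp [sheetPoint, sheetProfile]

theorem sheetProfile_div_eq_zero (hL : 0 < L) (κ : ℝ) (k : ℕ+) (p : ℝ × 𝕜) :
    sheetProfile κ L k p (L / k) = 0 := by
  have h : frequency L k p.1 * (L / k) = (1 : ℕ) * travelTime p.1 Real.pi := by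
    unfold frequency; field_simp; simp
  rw [sheetProfile, h, wave_nat_mul, mul_zero, zero_smul]

theorem sheetProfile_ne_zero (hL : 0 < L) {κ : ℝ} (hκ : κ ≠ 0) {k : ℕ+} {p : ℝ × 𝕜} (hs : p.1 ≠ 0)
    (hc : ‖p.2‖ = 1) {x : ℝ} (hx0 : 0 < x) (hx1 : x < L / k) : sheetProfile κ L k p x ≠ 0 := by
  have hω := frequency_pos hL k p.1
  have hw : 0 < wave p.1 (frequency L k p.1 * x) := by
    refine wave_pos (mul_pos hω hx0) ?_
    have h : frequency L k p.1 * (L / k) = travelTime p.1 Real.pi := by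
      unfold frequency; field_simp
    rw [← h]
    gcongr
  have hc0 : p.2 ≠ 0 := norm_ne_zero_iff.1 (by rw [hc]; exact one_ne_zero)
  exact smul_ne_zero (mul_ne_zero (mul_ne_zero hκ (mul_ne_zero hs hω.ne')) hw.ne') hc0

theorem div_mem_Icc (hL : 0 < L) {t : ℝ} (ht : 1 ≤ t) : L / t ∈ Icc 0 L :=
  ⟨by positivity, div_le_self hL.le ht⟩

theorem sheetPoint_mem_nontrivialSolutions (hhbar : 0 < hbar) (hm : 0 < m) (hg : 0 < g)
    (hL : 0 < L) (k : ℕ+) {p : ℝ × 𝕜} (hs : p.1 ≠ 0) (hc : ‖p.2‖ = 1) :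
    sheetPoint hbar m lam g L k p ∈ nontrivialSolutions 𝕜 hbar m lam g L := by
  have hA : 0 < hbar ^ 2 / (4 * m) := by positivity
  refine ⟨fun h => ?_, sheetProfile (scale hbar m g) L k p, ?_, fun x => rfl⟩
  · have hk : (1 : ℝ) ≤ k := by exact_mod_cast one_le (a := k)
    refine sheetProfile_ne_zero hL (scale_pos hhbar hm hg).ne' (k := k) hs hc
      (x := L / (2 * k)) (by positivity) ?_ ?_
    · gcongr
      linarith
    · exact congrArg (fun φ : C(Icc (0 : ℝ) L, 𝕜) => φ ⟨L / (2 * k), div_mem_Icc hL (by linarith)⟩) h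
  · refine (isCubicSolution_wave (L := L) p.1 (frequency L k p.1) _ p.2 ?_ ?_).isSolution
      hhbar hm ?_ ?_
    · rw [hc, mul_one, mul_pow, scale_sq hhbar hm hg]
      field_simp
    · rw [← frequency_mul_sq]
      simp only [sheetPoint]
      field_simp
      ring
    · simp [wave_zero]
    · have h : frequency L k p.1 * L = (k : ℕ) * travelTime p.1 Real.pi := by
        unfold frequency; field_simp
      simp only [h, wave_nat_mul, mul_zero, zero_smul]

theorem nontrivialSolutions_subset_iUnion_sheet (hhbar : 0 < hbar) (hm : 0 < m) (hg : 0 < g)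
    (hL : 0 < L) :
    nontrivialSolutions 𝕜 hbar m lam g L ⊆ ⋃ k, sheet 𝕜 hbar m lam g L k := by
  rintro ⟨β, φ⟩ ⟨hφ, f, hf, hφf⟩
  have hA : 0 < hbar ^ 2 / (4 * m) := by positivity
  dsimp only at hφ hf hφf
  obtain ⟨h, h', hh, hhf⟩ := hf.exists_isCubicSolution hhbar hm hL
  obtain ⟨k, s, a, c, hc, hs, ha, hb, hμ, hw⟩ := hh.exists_wave hL (by positivity)
    (by rw [hhf _ (left_mem_Icc.2 hL.le), hf.left])
    (by rw [hhf _ (right_mem_Icc.2 hL.le), hf.right])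
    (by
      by_contra! hz
      refine hφ (ContinuousMap.ext fun x => ?_)
      rw [hφf, ← hhf x x.2, hz x x.2, ContinuousMap.zero_apply])
  refine mem_iUnion.2 ⟨k, (s, c), hc, ?_⟩
  have hω := frequency_pos hL k s
  change _ = 2 * (s * frequency L k s) ^ 2 at hb
  change _ = frequency L k s ^ 2 * (1 + 2 * s ^ 2) at hμ
  refine Prod.ext ?_ (ContinuousMap.ext fun x => ?_)
  · simp only [sheetPoint]
    rw [frequency_mul_sq, ← hμ]
    field_simp
    ring
  · rw [hφf, ← hhf x x.2, hw x x.2]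
    have : a = (scale hbar m g) * (s * frequency L k s) := by
      have hκ := scale_pos hhbar hm hg
      rw [← sq_eq_sq₀ ha.le (by positivity), mul_pow, scale_sq hhbar hm hg]
      generalize hbar ^ 2 / (4 * m) = A at *
      field_simp at hb ⊢
      linarith
    rw [this]
    rfl

/-! ### Topology of the sheets and the branches -/

theorem disjoint_sheet (hhbar : 0 < hbar) (hm : 0 < m) (hg : 0 < g) (hL : 0 < L) {i j : ℕ+}
    (hij : i ≠ j) : Disjoint (sheet 𝕜 hbar m lam g L i) (sheet 𝕜 hbar m lam g L j) := by
  wlog hlt : i < j generalizing i j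
  · exact (this hij.symm (lt_of_le_of_ne (not_lt.1 hlt) hij.symm)).symm
  refine Set.disjoint_left.2 ?_
  rintro _ ⟨p, hp, rfl⟩ ⟨q, hq, h⟩
  have hκ := (scale_pos hhbar hm hg).ne'
  have hfun : ∀ x ∈ Icc 0 L, sheetProfile (scale hbar m g) L j q x =
      sheetProfile (scale hbar m g) L i p x := fun x hx => sheetProfile_eq_of_sheetPoint_eq h hx
  have hij' : (i : ℝ) < j := by exact_mod_cast hlt
  have hj : (1 : ℝ) ≤ j := by exact_mod_cast one_le (a := j)
  -- the first positive zero of the functions in the sheets distinguishes them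
  have hp0 : p.1 = 0 := by
    by_contra hp0
    refine sheetProfile_ne_zero hL hκ (k := i) hp0 hp (x := L / j) (by positivity) (by gcongr) ?_
    rw [← hfun _ (div_mem_Icc hL hj), sheetProfile_div_eq_zero hL]
  have hq0 : q.1 = 0 := by
    by_contra hq0
    refine sheetProfile_ne_zero hL hκ (k := j) hq0 hq (x := L / (2 * j)) (by positivity)
      (by gcongr; linarith) ?_
    rw [hfun _ (div_mem_Icc hL (by linarith))]
    simp [sheetProfile, hp0]
  have h1 := (Prod.ext_iff.1 h).1
  simp only [sheetPoint, hp0, hq0, levelFactor_zero] at h1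
  have hpi := Real.pi_pos
  have : hbar ^ 2 / (4 * m) * ((i / L) ^ 2 * Real.pi ^ 2) <
      hbar ^ 2 / (4 * m) * ((j / L) ^ 2 * Real.pi ^ 2) := by gcongr
  linarith

/-- On the `k`-th sheet `β ≤ ħ λ - ħ² (k π / L)² / (4 m)`, so that above any value of `β` there are only
finitely many sheets. -/
theorem locallyFinite_sheet (hhbar : 0 < hbar) (hm : 0 < m) (hL : 0 < L) :
    LocallyFinite (sheet 𝕜 hbar m lam g L) := by
  intro q
  refine ⟨{r | q.1 - 1 < r.1}, (isOpen_lt continuous_const continuous_fst).mem_nhds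
    (sub_one_lt q.1), ?_⟩
  have hpi := Real.pi_pos
  obtain ⟨n, hn⟩ := exists_nat_ge
    ((hbar * lam - (q.1 - 1)) / (hbar ^ 2 / (4 * m) * ((1 / L) ^ 2 * Real.pi ^ 2)))
  rw [div_le_iff₀ (by positivity)] at hn
  refine (Set.finite_Iic (⟨n + 1, n.succ_pos⟩ : ℕ+)).subset ?_
  rintro k ⟨_, ⟨p, -, rfl⟩, hk⟩
  have hk' : q.1 - 1 < hbar * lam - hbar ^ 2 / (4 * m) * ((k / L) ^ 2 * levelFactor p.1) := hk
  have h1 : hbar ^ 2 / (4 * m) * ((k / L) ^ 2 * Real.pi ^ 2) ≤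
      hbar ^ 2 / (4 * m) * ((k / L) ^ 2 * levelFactor p.1) := by
    gcongr
    exact pi_sq_le_levelFactor p.1
  have hk1 : (1 : ℝ) ≤ k := Nat.one_le_cast.2 k.2
  have h2 : (k : ℝ) * (hbar ^ 2 / (4 * m) * ((1 / L) ^ 2 * Real.pi ^ 2)) ≤
      hbar ^ 2 / (4 * m) * ((k / L) ^ 2 * Real.pi ^ 2) := by
    have : hbar ^ 2 / (4 * m) * ((k / L) ^ 2 * Real.pi ^ 2) =
      (k : ℝ) * (k * (hbar ^ 2 / (4 * m) * ((1 / L) ^ 2 * Real.pi ^ 2))) := by ring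
    rw [this]
    exact mul_le_mul_of_nonneg_left (le_mul_of_one_le_left (by positivity) hk1) (by positivity)
  have h3 : (k : ℝ) < n := by
    refine lt_of_mul_lt_mul_right (a := hbar ^ 2 / (4 * m) * ((1 / L) ^ 2 * Real.pi ^ 2)) ?_
      (by positivity)
    linarith
  have h4 : (k : ℕ) < n := by exact_mod_cast h3
  exact PNat.coe_le_coe _ _ |>.1 (h4.le.trans n.le_succ)

/-- The modulus is bounded on the part of a sheet where `β` is bounded below, so this part is contained in
a compact subset of the sheet. -/
theorem isClosed_sheet (hhbar : 0 < hbar) (hm : 0 < m) (hL : 0 < L) (k : ℕ+) :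
    IsClosed (sheet 𝕜 hbar m lam g L k) := by
  refine isClosed_of_closure_subset fun q hq => ?_
  obtain ⟨R, hR⟩ := exists_bound_of_levelFactor_le
    ((hbar * lam - (q.1 - 1)) / (hbar ^ 2 / (4 * m) * (k / L) ^ 2))
  have : ProperSpace 𝕜 := FiniteDimensional.proper ℝ 𝕜
  have hK : IsCompact (Icc (-R) R ×ˢ Metric.sphere (0 : 𝕜) 1) :=
    isCompact_Icc.prod (isCompact_sphere 0 1)
  have hK' := (hK.image (continuous_sheetPoint (hbar := hbar) (m := m) (lam := lam) (g := g)
    (L := L) k)).isClosed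
  have hU : IsOpen {r : ℝ × C(Icc (0 : ℝ) L, 𝕜) | q.1 - 1 < r.1} :=
    isOpen_lt continuous_const continuous_fst
  have hq' : q ∈ closure (sheet 𝕜 hbar m lam g L k ∩ {r | q.1 - 1 < r.1}) :=
    hU.closure_inter ⟨hq, sub_one_lt q.1⟩
  have hsub : sheet 𝕜 hbar m lam g L k ∩ {r | q.1 - 1 < r.1} ⊆
      sheetPoint hbar m lam g L k '' (Icc (-R) R ×ˢ Metric.sphere (0 : 𝕜) 1) := by
    rintro _ ⟨⟨p, hp, rfl⟩, hlt⟩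
    refine ⟨p, ⟨abs_le.1 (hR p.1 ?_), by simpa using hp⟩, rfl⟩
    have hlt' : q.1 - 1 < hbar * lam - hbar ^ 2 / (4 * m) * ((k / L) ^ 2 * levelFactor p.1) := hlt
    rw [le_div_iff₀ (by positivity)]
    linarith
  obtain ⟨p, hp, rfl⟩ := closure_minimal hsub hK' hq'
  exact ⟨p, by simpa using hp.2, rfl⟩

theorem closure_nontrivialSolutions_subset (hhbar : 0 < hbar) (hm : 0 < m) (hg : 0 < g)
    (hL : 0 < L) :
    closure (nontrivialSolutions 𝕜 hbar m lam g L) ⊆ ⋃ k, sheet 𝕜 hbar m lam g L k :=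
  closure_minimal (nontrivialSolutions_subset_iUnion_sheet hhbar hm hg hL)
    ((locallyFinite_sheet hhbar hm hL).isClosed_iUnion (isClosed_sheet hhbar hm hL))

theorem sheet_subset_closure (hhbar : 0 < hbar) (hm : 0 < m) (hg : 0 < g)
    (hL : 0 < L) (k : ℕ+) :
    sheet 𝕜 hbar m lam g L k ⊆ closure (nontrivialSolutions 𝕜 hbar m lam g L) := by
  rintro _ ⟨p, hp, rfl⟩
  have hc : Continuous fun s => sheetPoint hbar m lam g L k (s, p.2) :=
    (continuous_sheetPoint k).comp (Continuous.prodMk_left p.2)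
  have hd : p.1 ∈ closure ({0}ᶜ : Set ℝ) := by
    rw [(dense_compl_singleton (0 : ℝ)).closure_eq]; trivial
  exact map_mem_closure (f := fun s => sheetPoint hbar m lam g L k (s, p.2)) hc hd fun s hs =>
    sheetPoint_mem_nontrivialSolutions hhbar hm hg hL k hs hp

/-- The closure of the set of nontrivial solutions is covered by closed, pairwise disjoint, locally
finitely many sheets, so that a connected subset stays in one of them. -/
theorem branch_subset_sheet (hhbar : 0 < hbar) (hm : 0 < m) (hg : 0 < g) (hL : 0 < L) (k : ℕ+) :
    branch 𝕜 hbar m lam g L (criticalValue hbar m lam ((k * Real.pi / L) ^ 2)) ⊆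
      sheet 𝕜 hbar m lam g L k := by
  have hmem : ((criticalValue hbar m lam ((k * Real.pi / L) ^ 2), 0) : ℝ × C(Icc (0 : ℝ) L, 𝕜)) ∈
      sheet 𝕜 hbar m lam g L k := ⟨(0, 1), norm_one, sheetPoint_zero k 1⟩
  have hmem' := mem_connectedComponentIn (sheet_subset_closure hhbar hm hg hL k hmem)
  have hfin : LocallyFinite fun i : {i : ℕ+ // i ≠ k} => sheet 𝕜 hbar m lam g L i :=
    (locallyFinite_sheet hhbar hm hL).comp_injective Subtype.val_injective
  have hcl : IsClosed (⋃ i : {i : ℕ+ // i ≠ k}, sheet 𝕜 hbar m lam g L i) :=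
    hfin.isClosed_iUnion fun i => isClosed_sheet hhbar hm hL i
  have hdisj : Disjoint (sheet 𝕜 hbar m lam g L k)
      (⋃ i : {i : ℕ+ // i ≠ k}, sheet 𝕜 hbar m lam g L i) :=
    Set.disjoint_iUnion_right.2 fun i => disjoint_sheet hhbar hm hg hL i.2.symm
  have hcover : branch 𝕜 hbar m lam g L (criticalValue hbar m lam ((k * Real.pi / L) ^ 2)) ⊆
      sheet 𝕜 hbar m lam g L k ∪ ⋃ i : {i : ℕ+ // i ≠ k}, sheet 𝕜 hbar m lam g L i := by
    refine (connectedComponentIn_subset _ _).trans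
      ((closure_nontrivialSolutions_subset hhbar hm hg hL).trans (iUnion_subset fun i => ?_))
    by_cases hi : i = k
    · exact hi ▸ subset_union_left
    · exact (subset_iUnion (fun i : {i : ℕ+ // i ≠ k} => sheet 𝕜 hbar m lam g L i)
        ⟨i, hi⟩).trans subset_union_right
  rcases isPreconnected_iff_subset_of_disjoint_closed.1 isPreconnected_connectedComponentIn _ _
    (isClosed_sheet hhbar hm hL k) hcl hcover (by rw [hdisj.inter_eq, inter_empty]) with h | h
  · exact h
  · exact absurd (h hmem') (Set.disjoint_left.1 hdisj hmem)

/-- Letting the modulus go to zero connects every point of a sheet to the bifurcation point. -/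
theorem sheetPoint_mem_branch (hhbar : 0 < hbar) (hm : 0 < m) (hg : 0 < g) (hL : 0 < L) (k : ℕ+)
    {p : ℝ × 𝕜} (hp : ‖p.2‖ = 1) :
    sheetPoint hbar m lam g L k p ∈
      branch 𝕜 hbar m lam g L (criticalValue hbar m lam ((k * Real.pi / L) ^ 2)) := by
  have hc : Continuous fun s => sheetPoint hbar m lam g L k (s, p.2) :=
    (continuous_sheetPoint k).comp (Continuous.prodMk_left p.2)
  have hr := isPreconnected_range hc
  refine hr.subset_connectedComponentIn ⟨0, sheetPoint_zero k p.2⟩ ?_ ⟨p.1, rfl⟩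
  rintro _ ⟨s, rfl⟩
  exact sheet_subset_closure hhbar hm hg hL k ⟨(s, p.2), hp, rfl⟩

theorem IsBifurcatingFamily.mem_branch {β : ℝ} {I : Set ℝ} {φ : ℝ → C(Icc (0 : ℝ) L, 𝕜)}
    (h : IsBifurcatingFamily hbar m lam g L β I φ) {θ : ℝ} (hθ : θ ∈ I) :
    (θ, φ θ) ∈ branch 𝕜 hbar m lam g L β := by
  set S := (fun t => (t, φ t)) '' I with hS
  have hpre : IsPreconnected S :=
    h.ordConnected.isPreconnected.image _ (continuousOn_id.prodMk h.continuousOn)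
  have hsub : S ⊆ nontrivialSolutions 𝕜 hbar m lam g L := by
    rintro _ ⟨t, ht, rfl⟩
    exact h.solution t ht
  have hcl : (β, (0 : C(Icc (0 : ℝ) L, 𝕜))) ∈ closure S := by
    have : (𝓝[I] β).NeBot := mem_closure_iff_nhdsWithin_neBot.1 h.mem_closure
    have ht : Tendsto (fun t => (t, φ t)) (𝓝[I] β) (𝓝 (β, 0)) :=
      (tendsto_id.mono_left nhdsWithin_le_nhds).prodMk_nhds h.tendsto
    exact mem_closure_of_tendsto ht (eventually_mem_nhdsWithin.mono fun t ht => ⟨t, ht, rfl⟩)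
  exact hpre.closure.subset_connectedComponentIn hcl (closure_mono hsub)
    (subset_closure ⟨θ, hθ, rfl⟩)

theorem exists_sheetPoint_fst_eq (hhbar : 0 < hbar) (hm : 0 < m) (hL : 0 < L) (k : ℕ+) {β : ℝ}
    (hβ : β < criticalValue hbar m lam ((k * Real.pi / L) ^ 2)) :
    ∃ s, 0 < s ∧ ∀ c : 𝕜, (sheetPoint hbar m lam g L k (s, c)).1 = β := by
  have hA : 0 < hbar ^ 2 / (4 * m) := by positivity
  have hkL : (0 : ℝ) < k / L := by positivity
  obtain ⟨s, hs, h⟩ := exists_levelFactor_eq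
    (C := (hbar * lam - β) / (hbar ^ 2 / (4 * m) * (k / L) ^ 2)) (by
      rw [lt_div_iff₀ (by positivity)]
      unfold criticalValue at hβ
      have : Real.pi ^ 2 * (hbar ^ 2 / (4 * m) * (k / L) ^ 2) =
        hbar ^ 2 * (k * Real.pi / L) ^ 2 / (4 * m) := by ring
      linarith)
  refine ⟨s, hs, fun c => ?_⟩
  simp only [sheetPoint, h]
  field_simp
  ring

end

end BEC

theorem theorem4p4 {𝕜 : Type*} [RCLike 𝕜] (hbar m lam g L : ℝ) (hhbar : 0 < hbar) (hm : 0 < m)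
    (hg : 0 < g) (hL : 0 < L) (ξ : ℕ+ → ℝ) (hξ : BEC.IsDirichletSpectrum L ξ)
    (βc : ℕ+ → ℝ) (hβc : ∀ k, βc k = BEC.criticalValue hbar m lam (ξ k)) :
    (∀ i j : ℕ+, i ≠ j →
      (∀ (I J : Set ℝ) (φ ψ : ℝ → C(Set.Icc (0 : ℝ) L, 𝕜)),
        BEC.IsBifurcatingFamily hbar m lam g L (βc i) I φ →
        BEC.IsBifurcatingFamily hbar m lam g L (βc j) J ψ →
        ¬ ∃ θ : ℝ, θ ∈ I ∧ θ ∈ J ∧ φ θ = ψ θ) ∧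
      BEC.branch 𝕜 hbar m lam g L (βc i) ∩ BEC.branch 𝕜 hbar m lam g L (βc j) = ∅) ∧
    (∀ (j : ℕ+) (β : ℝ), βc (j + 1) < β → β < βc j →
      ∃ u : Fin (2 * (j : ℕ)) → C(Set.Icc (0 : ℝ) L, ℝ), Function.Injective u ∧
        ∀ n, (β, u n) ∈ BEC.nontrivialSolutions ℝ hbar m lam g L ∧
          ∃ k : ℕ+, (β, u n) ∈ BEC.branch ℝ hbar m lam g L (βc k)) := by
  have hβ : ∀ k, βc k = BEC.criticalValue hbar m lam ((k * Real.pi / L) ^ 2) := fun k => by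
    rw [hβc, hξ.eq hL]
  refine ⟨fun i j hij => ?_, fun j β _ hβj => ?_⟩
  · have hbr : BEC.branch 𝕜 hbar m lam g L (βc i) ∩ BEC.branch 𝕜 hbar m lam g L (βc j) = ∅ := by
      rw [hβ, hβ, ← Set.disjoint_iff_inter_eq_empty]
      exact (BEC.disjoint_sheet hhbar hm hg hL hij).mono
        (BEC.branch_subset_sheet hhbar hm hg hL i) (BEC.branch_subset_sheet hhbar hm hg hL j)
    refine ⟨?_, hbr⟩
    rintro I J φ ψ hφ hψ ⟨θ, hI, hJ, h⟩
    exact (hbr ▸ ⟨hφ.mem_branch hI, h ▸ hψ.mem_branch hJ⟩ : (θ, φ θ) ∈ (∅ : Set _))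
  · have hmono : ∀ k ≤ j, β < BEC.criticalValue hbar m lam ((k * Real.pi / L) ^ 2) :=
      fun k hk => by
        rw [← hξ.eq hL]
        refine hβj.trans_le ?_
        rw [hβc]
        have := hξ.strictMono.monotone hk
        unfold BEC.criticalValue
        gcongr
    -- `n = 2 (k - 1) + r` with `r < 2` stands for the solution with `k` half waves and sign `(-1)ʳ`
    let num : Fin (2 * (j : ℕ)) → ℕ+ := fun n => ⟨n / 2 + 1, Nat.succ_pos _⟩
    have hnum : ∀ n, num n ≤ j := fun n =>
      (PNat.coe_le_coe _ _).1 (by simp only [num, PNat.mk_coe]; omega)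
    let sgn : Fin (2 * (j : ℕ)) → ℝ := fun n => if (n : ℕ) % 2 = 0 then 1 else -1
    have hsgn : ∀ n, ‖sgn n‖ = 1 := fun n => by simp only [sgn]; split_ifs <;> simp
    choose! s hs hsβ using fun k hk =>
      BEC.exists_sheetPoint_fst_eq (𝕜 := ℝ) (g := g) hhbar hm hL k (hmono k hk)
    have hpt : ∀ n, ((β, (BEC.sheetPoint hbar m lam g L (num n) (s (num n), sgn n)).2) :
        ℝ × C(Set.Icc (0 : ℝ) L, ℝ)) =
        BEC.sheetPoint hbar m lam g L (num n) (s (num n), sgn n) := fun n =>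
      Prod.ext (hsβ _ (hnum n) _).symm rfl
    refine ⟨fun n => (BEC.sheetPoint hbar m lam g L (num n) (s (num n), sgn n)).2,
      fun n n' hnn => ?_, fun n => ⟨?_, num n, ?_⟩⟩
    · have heq : BEC.sheetPoint hbar m lam g L (num n) (s (num n), sgn n) =
          BEC.sheetPoint hbar m lam g L (num n') (s (num n'), sgn n') := by
        rw [← hpt n, ← hpt n']
        exact congrArg (Prod.mk β) hnn
      have hk : num n = num n' := by
        by_contra hne
        exact Set.disjoint_left.1 (BEC.disjoint_sheet hhbar hm hg hL hne)
          ⟨_, hsgn n, rfl⟩ ⟨_, hsgn n', heq.symm⟩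
      have hk1 : (1 : ℝ) ≤ num n' := by exact_mod_cast one_le (a := num n')
      have hx := BEC.div_mem_Icc hL (show (1 : ℝ) ≤ 2 * num n' by linarith)
      have hv : BEC.sheetProfile (BEC.scale hbar m g) L (num n') (s (num n'), sgn n)
          (L / (2 * num n')) = BEC.sheetProfile (BEC.scale hbar m g) L (num n')
          (s (num n'), sgn n') (L / (2 * num n')) := by
        rw [hk] at heq
        exact BEC.sheetProfile_eq_of_sheetPoint_eq heq hx
      have hne := BEC.sheetProfile_ne_zero (𝕜 := ℝ) (p := (s (num n'), sgn n')) (k := num n') hL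
        (BEC.scale_pos hhbar hm hg).ne' (hs _ (hnum n')).ne' (hsgn n')
        (x := L / (2 * num n')) (by positivity) (by gcongr; linarith)
      have hs' : sgn n = sgn n' := smul_right_injective ℝ (left_ne_zero_of_smul hne) hv
      have hk' : (n : ℕ) / 2 = n' / 2 := by
        have := congrArg PNat.val hk
        simpa [num] using this
      have hmod : (n : ℕ) % 2 = n' % 2 := by
        simp only [sgn] at hs'
        split_ifs at hs' <;> first | omega | norm_num at hs'
      exact Fin.ext (by omega)
    · rw [hpt]
      exact BEC.sheetPoint_mem_nontrivialSolutions hhbar hm hg hL _ (hs _ (hnum n)).ne' (hsgn n)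
    · rw [hpt, hβ]
      exact BEC.sheetPoint_mem_branch hhbar hm hg hL _ (hsgn n)
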